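/- Let $(\mathcal V, \otimes, I)$ be an arbitrary monoidal category. For a $\mathcal V$-functor $g : D \to E$ write $E(1,g)$ for the $\mathcal V$-distributor $(x,y) \mapsto E(x, gy)$, and for $\mathcal V$-functors $f,g : A \to E$ write $E(f,g)$ for $(x,y)\mapsto E(fx,gy)$. A $\mathcal V$-form $p_1,\dots,p_n \Rightarrow q$ between $\mathcal V$-distributors is a family of morphisms $p_1(x_0,x_1)\otimes\cdots\otimes p_n(x_{n-1},x_n)\to q(x_0,x_n)$ compatible with all the actions. A relative monad $T$ in $\mathcal V\text{-}\mathbf{Cat}$ consists of $\mathcal V$-functors $j, t : A \to E$, a $\mathcal V$-natural transformation $\eta$ with components $\eta_x : I \to E(jx,tx)$, and a $\mathcal V$-form $\dagger : E(j,t) \Rightarrow E(t,t)$, such that, for all $x,y,z \in A$, $E(\eta_x,ty)\circ\dagger_{x,y} = 1$, $\dagger_{x,x}\circ\eta_x = \mathsf I_{tx}$, and ${\circ}\cdot(\dagger_{x,y}\otimes\dagger_{y,z}) = \dagger_{x,z}\cdot{\circ}\cdot(1\otimes\dagger_{y,z})$ as morphisms $E(jx,ty)\otimes E(jy,tz) \to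 E(tx,tz)$. A $T$-opalgebra with codomain $B$ is a $\mathcal V$-functor $a : A \to B$ with a $\mathcal V$-form $\ltimes : E(j,t) \Rightarrow B(a,a)$ such that $\ltimes_{x,x}\circ\eta_x = \mathsf I_{ax}$ and ${\circ}\cdot(\ltimes_{x,y}\otimes\ltimes_{y,z}) = \ltimes_{x,z}\cdot{\circ}\cdot(1\otimes\dagger_{y,z})$. A $(p_1,\dots,p_n)$-graded morphism ($n \ge 0$) from $(a : A \to B,\ltimes)$ to $(a' : A \to B',\ltimes')$ is a $\mathcal V$-form $\alpha : p_1,\dots,p_n,B(1,a)\Rightarrow B'(1,a')$ that commutes with the actions $B(b,ax)\otimes E(jx,ty)\to B(b,ay)$ and $B'(b',a'x)\otimes E(jx,ty)\to B'(b',a'y)$ induced by $\ltimes$ and $\ltimes'$ and by composition. A $T$-opalgebra $(k : A \to K, \ltimes_T)$ is an opalgebra object for $T$ if 1. for every $T$-opalgebra $(a : A \to B,\ltimes)$ there is a unique $\mathcal V$-functor $[\,]_\ltimes : K \to B$ with $[\,]_\ltimes\circ k = a$ and $[\,]_\ltimes\circ{\ltimes_T} = {\ltimes}$; 2. for every graded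 morphism $\alpha : p_1,\dots,p_n,B(1,a)\Rightarrow B'(1,a')$ from $(a,\ltimes)$ to $(a',\ltimes')$ there is a unique $\mathcal V$-form $[\,]_\alpha : p_1,\dots,p_n,B(1,[\,]_\ltimes)\Rightarrow B'(1,[\,]_{\ltimes'})$ whose restriction along $k$ in the last variable is $\alpha$. **Theorem.** Every relative monad $T$ in $\mathcal V\text{-}\mathbf{Cat}$ admits an opalgebra object. Namely, let $\mathbf{Kl}(T)$ be the $\mathcal V$-category with the objects of $A$, hom-objects $\mathbf{Kl}(T)(x,y) = E(jx,ty)$, identities $\eta_x$ and composition $E(jx,ty)\otimes E(jy,tz)\xrightarrow{1\otimes\dagger_{y,z}}E(jx,ty)\otimes E(ty,tz)\xrightarrow{\circ}E(jx,tz)$, and let $k_T : A \to \mathbf{Kl}(T)$ be the identity-on-objects $\mathcal V$-functor acting by $A(x,y)\xrightarrow{j_{x,y}}E(jx,jy)\xrightarrow{E(jx,\eta_y)}E(jx,ty)$. Then $k_T$, with the identity $E(j,t) = \mathbf{Kl}(T)(k_T,k_T)$ as opextension operator, is an opalgebra object for $T$. -/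

import Mathlib

open CategoryTheory MonoidalCategory

universe w v u

noncomputable section

namespace VCat

variable {V : Type v} [Category.{w} V] [MonoidalCategory V]

/-! ### `V`-categories and `V`-distributors -/

/-- A (bundled) `V`-category, with objects in `Type u`. -/
structure VCategory (V : Type v) [Category.{w} V] [MonoidalCategory V] where
  /-- the objects -/
  Obj : Type u
  [enriched : EnrichedCategory V Obj]

instance : CoeSort (VCategory.{w, v, u} V) (Type u) := ⟨VCategory.Obj⟩

instance (C : VCategory.{w, v, u} V) : EnrichedCategory V C := C.enriched


/-- A `V`-distributor `p : D ⇸ C`: objects `p(x, y)` of `V` for `x ∈ C`, `y ∈ D`, with compatible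
actions of `C` on the left and of `D` on the right. -/
structure Distributor (C D : VCategory.{w, v, u} V) where
  /-- the object `p(x, y)` -/
  obj : C → D → V
  /-- the action `C(x', x) ⊗ p(x, y) ⟶ p(x', y)` -/
  lact (x' x : C) (y : D) : (x' ⟶[V] x) ⊗ obj x y ⟶ obj x' y
  /-- the action `p(x, y) ⊗ D(y, y') ⟶ p(x, y')` -/
  ract (x : C) (y y' : D) : obj x y ⊗ (y ⟶[V] y') ⟶ obj x y'
  lact_id (x : C) (y : D) : eId V x ▷ obj x y ≫ lact x x y = (λ_ (obj x y)).hom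
  lact_comp (x'' x' x : C) (y : D) :
    eComp V x'' x' x ▷ obj x y ≫ lact x'' x y =
      (α_ _ _ _).hom ≫ (x'' ⟶[V] x') ◁ lact x' x y ≫ lact x'' x' y
  ract_id (x : C) (y : D) : obj x y ◁ eId V y ≫ ract x y y = (ρ_ (obj x y)).hom
  ract_comp (x : C) (y y' y'' : D) :
    obj x y ◁ eComp V y y' y'' ≫ ract x y y'' =
      (α_ _ _ _).inv ≫ ract x y y' ▷ (y' ⟶[V] y'') ≫ ract x y' y''
  lact_ract (x' x : C) (y y' : D) :
    lact x' x y ▷ (y ⟶[V] y') ≫ ract x' y y' =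
      (α_ _ _ _).hom ≫ (x' ⟶[V] x) ◁ ract x y y' ≫ lact x' x y'

/-- The loose-identity of `C`: the `V`-distributor `(x, y) ↦ C(x, y)`. -/
abbrev homDistributor (C : VCategory.{w, v, u} V) : Distributor C C where
  obj x y := x ⟶[V] y
  lact x' x y := eComp V x' x y
  ract x y y' := eComp V x y y'
  lact_id x y := by
    have h := e_id_comp V x y
    rwa [Iso.inv_comp_eq, Category.comp_id] at h
  lact_comp x'' x' x y := by
    rw [← e_assoc, Iso.hom_inv_id_assoc]
  ract_id x y := by
    have h := e_comp_id V x y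
    rwa [Iso.inv_comp_eq, Category.comp_id] at h
  ract_comp x y y' y'' := by rw [e_assoc]
  lact_ract x' x y y' := by
    rw [← e_assoc, Iso.hom_inv_id_assoc]

/-- The restriction `p(f, g)` of a `V`-distributor `p` along `V`-functors `f` and `g`. -/
abbrev Distributor.restrict {C D C' D' : VCategory.{w, v, u} V} (p : Distributor C D)
    (f : EnrichedFunctor V C' C) (g : EnrichedFunctor V D' D) : Distributor C' D' where
  obj x y := p.obj (f.obj x) (g.obj y)
  lact x' x y := f.map x' x ▷ _ ≫ p.lact (f.obj x') (f.obj x) (g.obj y)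
  ract x y y' := _ ◁ g.map y y' ≫ p.ract (f.obj x) (g.obj y) (g.obj y')
  lact_id x y := by
    rw [← comp_whiskerRight_assoc, f.map_id, p.lact_id]
  lact_comp x'' x' x y := by
    rw [← comp_whiskerRight_assoc, f.map_comp, comp_whiskerRight_assoc, p.lact_comp]
    simp only [MonoidalCategory.whiskerLeft_comp, Category.assoc, MonoidalCategory.tensorHom_def]
    simp only [comp_whiskerRight, Category.assoc, associator_naturality_left_assoc,
      whisker_assoc, Iso.inv_hom_id_assoc]
    simp only [← whisker_exchange_assoc]
  ract_id x y := by
    rw [← whiskerLeft_comp_assoc, g.map_id, p.ract_id]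
  ract_comp x y y' y'' := by
    rw [← whiskerLeft_comp_assoc, g.map_comp, whiskerLeft_comp_assoc, p.ract_comp]
    simp only [comp_whiskerRight, Category.assoc, MonoidalCategory.tensorHom_def', MonoidalCategory.whiskerLeft_comp,
      associator_inv_naturality_right_assoc, associator_inv_naturality_middle_assoc,
      whisker_exchange_assoc]
  lact_ract x' x y y' := by
    simp only [comp_whiskerRight, Category.assoc, MonoidalCategory.whiskerLeft_comp]
    rw [← whisker_exchange_assoc, p.lact_ract, whisker_exchange_assoc,
      associator_naturality_right_assoc, associator_naturality_left_assoc, whisker_exchange_assoc]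

/-- The `V`-distributor `E(f, g) : (x, y) ↦ E(f x, g y)`. -/
abbrev homOf {C D E : VCategory.{w, v, u} V} (f : EnrichedFunctor V C E)
    (g : EnrichedFunctor V D E) : Distributor C D :=
  (homDistributor E).restrict f g

/-- The `V`-distributor `E(1, g) : (x, y) ↦ E(x, g y)`. -/
abbrev homFrom {D E : VCategory.{w, v, u} V} (g : EnrichedFunctor V D E) : Distributor E D where
  obj x y := x ⟶[V] g.obj y
  lact x' x y := eComp V x' x (g.obj y)
  ract x y y' := _ ◁ g.map y y' ≫ eComp V x (g.obj y) (g.obj y')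
  lact_id x y := (homDistributor E).lact_id x (g.obj y)
  lact_comp x'' x' x y := (homDistributor E).lact_comp x'' x' x (g.obj y)
  ract_id x y := by
    rw [← whiskerLeft_comp_assoc, g.map_id, (homDistributor E).ract_id]
  ract_comp x y y' y'' := by
    rw [← whiskerLeft_comp_assoc, g.map_comp, whiskerLeft_comp_assoc, (homDistributor E).ract_comp]
    simp only [comp_whiskerRight, Category.assoc, MonoidalCategory.tensorHom_def',
      MonoidalCategory.whiskerLeft_comp, associator_inv_naturality_right_assoc,
      associator_inv_naturality_middle_assoc, whisker_exchange_assoc]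
  lact_ract x' x y y' := by
    rw [← whisker_exchange_assoc, (homDistributor E).lact_ract, associator_naturality_right_assoc,
      MonoidalCategory.whiskerLeft_comp_assoc]

/-! ### `V`-forms -/

/-- Chains `p₁, …, pₙ` (`n ≥ 0`) of `V`-distributors `pᵢ : Cᵢ ⇸ Cᵢ₋₁`, with `C = C₀`, `D = Cₙ`. -/
inductive Chain (C : VCategory.{w, v, u} V) : VCategory.{w, v, u} V → Type (max w v (u + 1))
  | nil : Chain C C
  | snoc {D D' : VCategory.{w, v, u} V} (c : Chain C D) (p : Distributor D D') : Chain C D'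

/-- The chain with the single member `p`. -/
abbrev Chain.single {C D : VCategory.{w, v, u} V} (p : Distributor C D) : Chain C D :=
  Chain.nil.snoc p

/-- Sequences of objects `x₀ ∈ C₀, …, xₙ ∈ Cₙ` along a chain, with given `x₀` and `xₙ`. -/
inductive Chain.Points {C : VCategory.{w, v, u} V} (x₀ : C) :
    {D : VCategory.{w, v, u} V} → Chain C D → D → Type (max w v (u + 1))
  | nil : Points x₀ Chain.nil x₀
  | snoc {D D' : VCategory.{w, v, u} V} {c : Chain C D} {p : Distributor D D'} {y : D}
      (s : Points x₀ c y) (z : D') : Points x₀ (c.snoc p) z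

namespace Chain.Points

/-- The object `p₁(x₀, x₁) ⊗ ⋯ ⊗ pₙ(xₙ₋₁, xₙ)` of `V`, bracketed from the left and starting from the
unit: `((I ⊗ p₁(x₀, x₁)) ⊗ ⋯) ⊗ pₙ(xₙ₋₁, xₙ)`. -/
@[reducible]
def tensor {C : VCategory.{w, v, u} V} {x₀ : C} : {D : VCategory.{w, v, u} V} → {c : Chain C D} →
    {z : D} → Points x₀ c z → V
  | _, _, _, nil => 𝟙_ V
  | _, _, _, snoc (p := p) (y := y) s z => s.tensor ⊗ p.obj y z

/-- `LeftStep s s' l` says that the chain is not empty, that `s'` arises from `s` by replacing the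
first object `x` by `x'`, and that
`l : C(x', x) ⊗ (p₁(x, x₁) ⊗ ⋯) ⟶ p₁(x', x₁) ⊗ ⋯` is the left action on the first factor. -/
inductive LeftStep {C : VCategory.{w, v, u} V} {x x' : C} :
    {D : VCategory.{w, v, u} V} → {c : Chain C D} → {z : D} →
    (s : Points x c z) → (s' : Points x' c z) → (((x' ⟶[V] x) ⊗ s.tensor) ⟶ s'.tensor) → Prop
  | single {D : VCategory.{w, v, u} V} {p : Distributor C D} (z : D) :
      LeftStep (nil.snoc (p := p) z) (nil.snoc (p := p) z)
        ((x' ⟶[V] x) ◁ (λ_ (p.obj x z)).hom ≫ p.lact x' x z ≫ (λ_ (p.obj x' z)).inv)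
  | snoc {D D' : VCategory.{w, v, u} V} {c : Chain C D} {p : Distributor D D'}
      {y : D} {s : Points x c y} {s' : Points x' c y} {l : ((x' ⟶[V] x) ⊗ s.tensor) ⟶ s'.tensor}
      (h : LeftStep s s' l) (z : D') :
      LeftStep (s.snoc (p := p) z) (s'.snoc (p := p) z)
        ((α_ (x' ⟶[V] x) s.tensor (p.obj y z)).inv ≫ l ▷ p.obj y z)

/-- `InnerStep s s' r l` says that `s` and `s'` differ only in one inner place, with `xᵢ = x'` in `s`
and `xᵢ = x` in `s'` (`1 ≤ i < n`), and that
`r : ⋯ ⊗ pᵢ(xᵢ₋₁, x) ⊗ Cᵢ(x, x') ⊗ pᵢ₊₁(x', xᵢ₊₁) ⊗ ⋯ ⟶ ⋯ ⊗ pᵢ(xᵢ₋₁, x') ⊗ pᵢ₊₁(x', xᵢ₊₁) ⊗ ⋯` and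
`l : ⋯ ⊗ pᵢ(xᵢ₋₁, x) ⊗ Cᵢ(x, x') ⊗ pᵢ₊₁(x', xᵢ₊₁) ⊗ ⋯ ⟶ ⋯ ⊗ pᵢ(xᵢ₋₁, x) ⊗ pᵢ₊₁(x, xᵢ₊₁) ⊗ ⋯`
are the right action on `pᵢ` and the left action on `pᵢ₊₁`. -/
inductive InnerStep {C : VCategory.{w, v, u} V} {x₀ : C} :
    {D : VCategory.{w, v, u} V} → {c : Chain C D} → {z : D} →
    (s s' : Points x₀ c z) → {X : V} → (X ⟶ s.tensor) → (X ⟶ s'.tensor) → Prop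
  | last {D D' D'' : VCategory.{w, v, u} V} {c : Chain C D} {p : Distributor D D'}
      {q : Distributor D' D''} {y : D} (s : Points x₀ c y) (x x' : D') (z : D'') :
      InnerStep ((s.snoc (p := p) x').snoc (p := q) z) ((s.snoc (p := p) x).snoc (p := q) z)
        (X := ((s.tensor ⊗ p.obj y x) ⊗ (x ⟶[V] x')) ⊗ q.obj x' z)
        (((α_ s.tensor (p.obj y x) (x ⟶[V] x')).hom ≫ s.tensor ◁ p.ract y x x') ▷ q.obj x' z)
        ((α_ (s.tensor ⊗ p.obj y x) (x ⟶[V] x') (q.obj x' z)).hom ≫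
          (s.tensor ⊗ p.obj y x) ◁ q.lact x x' z)
  | snoc {D D' : VCategory.{w, v, u} V} {c : Chain C D} {p : Distributor D D'} {y : D}
      {s s' : Points x₀ c y} {X : V} {r : X ⟶ s.tensor} {l : X ⟶ s'.tensor}
      (h : InnerStep s s' r l) (z : D') :
      InnerStep (s.snoc (p := p) z) (s'.snoc (p := p) z)
        (X := X ⊗ p.obj y z) (r ▷ p.obj y z) (l ▷ p.obj y z)

end Chain.Points

open Chain

/-- The `V`-naturality conditions on a family of morphisms
`p₁(x₀, x₁) ⊗ ⋯ ⊗ pₙ(xₙ₋₁, xₙ) ⟶ q(x₀, xₙ)`: a single condition if `n = 0`; if `n ≥ 1`,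
compatibility with the left action of `C₀`, with the right action of `Cₙ`, and with the actions of
`C₁, …, Cₙ₋₁`. -/
def IsNatural {C : VCategory.{w, v, u} V} : {D : VCategory.{w, v, u} V} → (c : Chain C D) →
    (q : Distributor C D) → (∀ {x : C} {z : D} (s : Points x c z), s.tensor ⟶ q.obj x z) → Prop
  | _, .nil, q, φ => ∀ x x' : C,
      (λ_ (x ⟶[V] x')).inv ≫ φ (.nil (x₀ := x)) ▷ (x ⟶[V] x') ≫ q.ract x x x' =
        (ρ_ (x ⟶[V] x')).inv ≫ (x ⟶[V] x') ◁ φ (.nil (x₀ := x')) ≫ q.lact x x' x'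
  | D, .snoc (D := D₁) c p, q, φ =>
      (∀ {x x' : C} {z : D} {s : Points x (c.snoc p) z} {s' : Points x' (c.snoc p) z}
        {l : ((x' ⟶[V] x) ⊗ s.tensor) ⟶ s'.tensor}, Points.LeftStep s s' l →
          l ≫ φ s' = (x' ⟶[V] x) ◁ φ s ≫ q.lact x' x z) ∧
      (∀ {x : C} {y : D₁} (s : Points x c y) (z z' : D),
        (α_ s.tensor (p.obj y z) (z ⟶[V] z')).hom ≫ s.tensor ◁ p.ract y z z' ≫ φ (s.snoc z') =
          φ (s.snoc z) ▷ (z ⟶[V] z') ≫ q.ract x z z') ∧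
      (∀ {x : C} {z : D} {s s' : Points x (c.snoc p) z} {X : V} {r : X ⟶ s.tensor}
        {l : X ⟶ s'.tensor}, Points.InnerStep s s' r l → r ≫ φ s = l ≫ φ s')

/-- A `V`-form `φ : p₁, …, pₙ ⇒ q`, i.e. a 2-cell of `V`-Cat whose vertical sides are identities.
(A `V`-form into `q` with vertical sides `f` and `g` is a `V`-form into `q(f, g)` in this sense.) -/
structure Form {C D : VCategory.{w, v, u} V} (c : Chain C D) (q : Distributor C D) where
  /-- the component `p₁(x₀, x₁) ⊗ ⋯ ⊗ pₙ(xₙ₋₁, xₙ) ⟶ q(x₀, xₙ)` -/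
  app {x : C} {z : D} (s : Points x c z) : s.tensor ⟶ q.obj x z
  natural : IsNatural c q app

namespace Form

/-- The component `I ⟶ q(x, x)` of a nullary `V`-form. -/
def app₀ {C : VCategory.{w, v, u} V} {q : Distributor C C} (φ : Form Chain.nil q) (x : C) :
    𝟙_ V ⟶ q.obj x x :=
  φ.app (.nil (x₀ := x))

/-- The component `p(x, y) ⟶ q(x, y)` of a unary `V`-form. -/
def app₁ {C D : VCategory.{w, v, u} V} {p q : Distributor C D} (φ : Form (Chain.single p) q)
    (x : C) (y : D) : p.obj x y ⟶ q.obj x y :=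
  (λ_ (p.obj x y)).inv ≫ φ.app ((Points.nil (x₀ := x)).snoc y)

/-- The composite of a `V`-form with a family of morphisms `q(x, z) ⟶ q'(x, z)` that is compatible
with the actions. -/
def mapTarget {C D : VCategory.{w, v, u} V} {c : Chain C D} {q q' : Distributor C D} (φ : Form c q)
    (θ : ∀ x z, q.obj x z ⟶ q'.obj x z)
    (hl : ∀ x' x z, q.lact x' x z ≫ θ x' z = (x' ⟶[V] x) ◁ θ x z ≫ q'.lact x' x z)
    (hr : ∀ x z z', q.ract x z z' ≫ θ x z' = θ x z ▷ (z ⟶[V] z') ≫ q'.ract x z z') :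
    Form c q' where
  app {x z} s := φ.app s ≫ θ x z
  natural := by
    have h := φ.natural
    cases c with
    | nil =>
      intro x x'
      have h' := h x x' =≫ θ x x'
      simp only [Category.assoc, hl, hr] at h'
      simpa only [comp_whiskerRight, MonoidalCategory.whiskerLeft_comp, Category.assoc] using h'
    | snoc c p =>
      refine ⟨fun {x x' z s s' l} hs => ?_, fun {x y} s z z' => ?_, fun {x z s s' X r l} hs => ?_⟩
      · have h' := h.1 hs =≫ θ x' z
        simp only [Category.assoc, hl] at h'
        simpa only [MonoidalCategory.whiskerLeft_comp, Category.assoc] using h'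
      · have h' := h.2.1 s z z' =≫ θ x z'
        simp only [Category.assoc, hr] at h'
        simpa only [comp_whiskerRight, Category.assoc] using h'
      · have h' := h.2.2 hs =≫ θ x z
        simpa only [Category.assoc] using h'

/-- The `V`-form `φ ; F : p₁, …, pₙ ⇒ D(f F, g F)` obtained from a `V`-form
`φ : p₁, …, pₙ ⇒ C(f, g)` and a `V`-functor `F : C → D`. -/
def postcomp {A B C D : VCategory.{w, v, u} V} {c : Chain A B} {f : EnrichedFunctor V A C}
    {g : EnrichedFunctor V B C} (φ : Form c (homOf f g)) (F : EnrichedFunctor V C D) :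
    Form c (homOf (f.comp V F) (g.comp V F)) :=
  φ.mapTarget (fun x z => F.map (f.obj x) (g.obj z))
    (fun x' x z => by
      change (f.map x' x ▷ _ ≫ eComp V _ _ _) ≫ F.map _ _ =
        _ ◁ F.map _ _ ≫ (f.map x' x ≫ F.map _ _) ▷ _ ≫ eComp V _ _ _
      rw [Category.assoc, F.map_comp, MonoidalCategory.tensorHom_def, comp_whiskerRight_assoc,
        whisker_exchange_assoc,
        Category.assoc, whisker_exchange_assoc])
    (fun x z z' => by
      change (_ ◁ g.map z z' ≫ eComp V _ _ _) ≫ F.map _ _ =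
        F.map _ _ ▷ _ ≫ _ ◁ (g.map z z' ≫ F.map _ _) ≫ eComp V _ _ _
      rw [Category.assoc, F.map_comp, tensorHom_def', Category.assoc, whiskerLeft_comp_assoc,
        ← whisker_exchange_assoc, ← whisker_exchange_assoc])

theorem app₁_postcomp {A B C D : VCategory.{w, v, u} V} {p : Distributor A B}
    {f : EnrichedFunctor V A C} {g : EnrichedFunctor V B C}
    (φ : Form (Chain.single p) (homOf f g)) (F : EnrichedFunctor V C D) (x : A) (y : B) :
    (φ.postcomp F).app₁ x y = φ.app₁ x y ≫ F.map (f.obj x) (g.obj y) :=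
  (Category.assoc _ _ _).symm

end Form

/-! ### Relative monads -/

/-- For `g : I ⟶ E(y, z)`, the morphism `E(x, g) : E(x, y) ⟶ E(x, z)`. -/
def homPost {E : VCategory.{w, v, u} V} (x : E) {y z : E} (g : 𝟙_ V ⟶ (y ⟶[V] z)) :
    (x ⟶[V] y) ⟶ (x ⟶[V] z) :=
  (ρ_ (x ⟶[V] y)).inv ≫ (x ⟶[V] y) ◁ g ≫ eComp V x y z

/-- For `g : I ⟶ E(x, y)`, the morphism `E(g, z) : E(y, z) ⟶ E(x, z)`. -/
def homPre {E : VCategory.{w, v, u} V} {x y : E} (g : 𝟙_ V ⟶ (x ⟶[V] y)) (z : E) :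
    (y ⟶[V] z) ⟶ (x ⟶[V] z) :=
  (λ_ (y ⟶[V] z)).inv ≫ g ▷ (y ⟶[V] z) ≫ eComp V x y z

theorem eId_homPost {E : VCategory.{w, v, u} V} {x y : E} (g : 𝟙_ V ⟶ (x ⟶[V] y)) :
    eId V x ≫ homPost x g = g := by
  rw [homPost, rightUnitor_inv_naturality_assoc, ← whisker_exchange_assoc,
    ← unitors_inv_equal, ← leftUnitor_inv_naturality_assoc, e_id_comp, Category.comp_id]

theorem eComp_homPost {E : VCategory.{w, v, u} V} (x y : E) {z z' : E}
    (g : 𝟙_ V ⟶ (z ⟶[V] z')) :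
    eComp V x y z ≫ homPost x g = (x ⟶[V] y) ◁ homPost y g ≫ eComp V x y z' := by
  simp only [homPost, MonoidalCategory.whiskerLeft_comp, Category.assoc]
  rw [← e_assoc, rightUnitor_inv_naturality_assoc, ← whisker_exchange_assoc,
    associator_inv_naturality_right_assoc]
  simp

theorem homPost_comp {E : VCategory.{w, v, u} V} (x : E) {y y' : E}
    (g : 𝟙_ V ⟶ (y ⟶[V] y')) (z : E) :
    homPost x g ▷ (y' ⟶[V] z) ≫ eComp V x y' z = (x ⟶[V] y) ◁ homPre g z ≫ eComp V x y z := by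
  simp only [homPost, homPre, MonoidalCategory.whiskerLeft_comp, comp_whiskerRight, Category.assoc]
  rw [← e_assoc, associator_inv_naturality_middle_assoc]
  simp

/-- A relative monad in `V`-Cat: `V`-functors `j, t : A → E` with a unit `η : j ⇒ t`, a nullary
`V`-form into `E(j, t)`, and an extension operator `† : E(j, t) ⇒ E(t, t)`, satisfying the two unit
laws and the associativity law (stated on components). -/
structure RelativeMonad (A E : VCategory.{w, v, u} V) where
  /-- the root -/
  j : EnrichedFunctor V A E
  /-- the underlying `V`-functor -/
  t : EnrichedFunctor V A E
  /-- the extension operator -/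
  ext : Form (Chain.single (homOf j t)) (homOf t t)
  /-- the unit -/
  η : Form Chain.nil (homOf j t)
  ext_unit (x y : A) : ext.app₁ x y ≫ homPre (η.app₀ x) (t.obj y) = 𝟙 (j.obj x ⟶[V] t.obj y)
  unit_ext (x : A) : η.app₀ x ≫ ext.app₁ x x = eId V (t.obj x)
  ext_assoc (x y z : A) :
    (ext.app₁ x y ⊗ₘ ext.app₁ y z) ≫ eComp V (t.obj x) (t.obj y) (t.obj z) =
      (j.obj x ⟶[V] t.obj y) ◁ ext.app₁ y z ≫ eComp V (j.obj x) (t.obj y) (t.obj z) ≫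
        ext.app₁ x z

namespace RelativeMonad

variable {A E : VCategory.{w, v, u} V} (T : RelativeMonad A E)

/-! ### Opalgebras -/

/-- A `T`-opalgebra structure on a `V`-functor `a : A → B`: an opextension operator
`⋉ : E(j, t) ⇒ B(a, a)`, satisfying the unit law and the extension law. -/
structure OpalgebraStructure {B : VCategory.{w, v, u} V} (a : EnrichedFunctor V A B) where
  /-- the opextension operator -/
  opext : Form (Chain.single (homOf T.j T.t)) (homOf a a)
  unit_opext (x : A) : T.η.app₀ x ≫ opext.app₁ x x = eId V (a.obj x)
  opext_opext (x y z : A) :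
    (opext.app₁ x y ⊗ₘ opext.app₁ y z) ≫ eComp V (a.obj x) (a.obj y) (a.obj z) =
      (T.j.obj x ⟶[V] T.t.obj y) ◁ T.ext.app₁ y z ≫
        eComp V (T.j.obj x) (T.t.obj y) (T.t.obj z) ≫ opext.app₁ x z

/-- A `T`-opalgebra with codomain `B`. -/
structure Opalgebra (B : VCategory.{w, v, u} V) where
  /-- the underlying `V`-functor -/
  functor : EnrichedFunctor V A B
  str : T.OpalgebraStructure functor

namespace Opalgebra

variable {T}

/-- The opalgebra `(a ; F, ⋉ ; F)` obtained from an opalgebra `(a, ⋉)` with codomain `B` by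
postcomposing both `a` and `⋉` with a `V`-functor `F : B → B'`. -/
def postcomp {B B' : VCategory.{w, v, u} V} (o : T.Opalgebra B) (F : EnrichedFunctor V B B') :
    T.Opalgebra B' where
  functor := o.functor.comp V F
  str :=
    { opext := o.str.opext.postcomp F
      unit_opext := fun x => by
        have h := o.str.unit_opext x =≫ F.map (o.functor.obj x) (o.functor.obj x)
        rw [Category.assoc, F.map_id] at h
        rw [Form.app₁_postcomp]
        exact h
      opext_opext := fun x y z => by
        have h := o.str.opext_opext x y z =≫ F.map (o.functor.obj x) (o.functor.obj z)
        simp only [Category.assoc, F.map_comp, tensorHom_comp_tensorHom_assoc] at h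
        rw [Form.app₁_postcomp, Form.app₁_postcomp, Form.app₁_postcomp]
        exact h }

/-- The right action `ρ : B(1, a), E(j, t) ⇒ B(1, a)` of an opalgebra `(a, ⋉)`, on components:
`B(b, a x) ⊗ E(j x, t y) ⟶ B(b, a x) ⊗ B(a x, a y) ⟶ B(b, a y)`. -/
def action {B : VCategory.{w, v, u} V} (o : T.Opalgebra B) (b : B) (x y : A) :
    (b ⟶[V] o.functor.obj x) ⊗ (T.j.obj x ⟶[V] T.t.obj y) ⟶ (b ⟶[V] o.functor.obj y) :=
  (b ⟶[V] o.functor.obj x) ◁ o.str.opext.app₁ x y ≫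
    eComp V b (o.functor.obj x) (o.functor.obj y)

/-- A `V`-form `α : p₁, …, pₙ, B(1, a) ⇒ B'(1, a')` is a `(p₁, …, pₙ)`-graded morphism between the
opalgebras `(a, ⋉)` and `(a', ⋉')` when it commutes with their actions, as `V`-forms
`p₁, …, pₙ, B(1, a), E(j, t) ⇒ B'(1, a')`. -/
def IsGradedMorphism {B B' : VCategory.{w, v, u} V} {c : Chain B' B} (o : T.Opalgebra B)
    (o' : T.Opalgebra B') (α : Form (c.snoc (homFrom o.functor)) (homFrom o'.functor)) : Prop :=
  ∀ {x₀ : B'} {xₙ : B} (s : Points x₀ c xₙ) (x y : A),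
    (α_ s.tensor (xₙ ⟶[V] o.functor.obj x) (T.j.obj x ⟶[V] T.t.obj y)).hom ≫
        s.tensor ◁ o.action xₙ x y ≫ α.app (s.snoc y) =
      α.app (s.snoc x) ▷ (T.j.obj x ⟶[V] T.t.obj y) ≫ o'.action x₀ x y

/-- `(k, ⋉)` is an opalgebra object for `T`.

In `existsUnique_form`, the opalgebras `o.postcomp F` and `o.postcomp F'` are arbitrary opalgebras
and `F`, `F'` the `V`-functors that they induce, by `existsUnique_functor`; the last
condition says that `α` is the restriction of `β` along `k` in the last variable. -/
structure IsOpalgebraObject {K : VCategory.{w, v, u} V} (o : T.Opalgebra K) : Prop where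
  existsUnique_functor {B : VCategory.{w, v, u} V} (o' : T.Opalgebra B) :
    ∃! F : EnrichedFunctor V K B, o.postcomp F = o'
  existsUnique_form {B B' : VCategory.{w, v, u} V} (F : EnrichedFunctor V K B)
    (F' : EnrichedFunctor V K B') (c : Chain B' B)
    (α : Form (c.snoc (homFrom (o.postcomp F).functor)) (homFrom (o.postcomp F').functor))
    (hα : (o.postcomp F).IsGradedMorphism (o.postcomp F') α) :
    ∃! β : Form (c.snoc (homFrom F)) (homFrom F'),
      ∀ {x₀ : B'} {xₙ : B} (s : Points x₀ c xₙ) (y : A),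
        β.app (s.snoc (o.functor.obj y)) = α.app (s.snoc y)

end Opalgebra

/-- `T` admits an opalgebra object. -/
def AdmitsOpalgebraObject : Prop :=
  ∃ (K : VCategory.{w, v, u} V) (o : T.Opalgebra K), o.IsOpalgebraObject

/-! ### The Kleisli `V`-category -/

/-- The Kleisli `V`-category `Kl(T)`: its objects are those of `A`, its hom-objects are
`E(j x, t y)`, identities are given by the unit, and composition is
`E(j x, t y) ⊗ E(j y, t z) ⟶ E(j x, t y) ⊗ E(t y, t z) ⟶ E(j x, t z)`. -/
def kleisli : VCategory.{w, v, u} V where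
  Obj := A
  enriched :=
    { Hom := fun x y => T.j.obj x ⟶[V] T.t.obj y
      id := fun x => T.η.app₀ x
      comp := fun x y z => (T.j.obj x ⟶[V] T.t.obj y) ◁ T.ext.app₁ y z ≫
        eComp V (T.j.obj x) (T.t.obj y) (T.t.obj z)
      id_comp := fun x y => by
        rw [← whisker_exchange_assoc, ← leftUnitor_inv_naturality_assoc]
        exact T.ext_unit x y
      comp_id := fun x y => by
        rw [← MonoidalCategory.whiskerLeft_comp_assoc, T.unit_ext, e_comp_id]
      assoc := fun x y z z' => by
        rw [← MonoidalCategory.whiskerLeft_comp_assoc, Category.assoc, ← T.ext_assoc,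
          MonoidalCategory.whiskerLeft_comp_assoc, ← e_assoc, MonoidalCategory.tensorHom_def]
        simp only [comp_whiskerRight, Category.assoc, MonoidalCategory.whiskerLeft_comp,
          ← whisker_exchange_assoc, associator_inv_naturality_right_assoc,
          associator_inv_naturality_middle_assoc] }

/-- The Kleisli inclusion `k_T : A → Kl(T)`, the identity on objects, with action
`A(x, y) ⟶ E(j x, j y) ⟶ E(j x, t y)` on hom-objects. -/
def kleisliInclusion : EnrichedFunctor V A T.kleisli where
  obj x := x
  map x y := T.j.map x y ≫ homPost (T.j.obj x) (T.η.app₀ y)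
  map_id x := by
    have h : eId V x ≫ T.j.map x x ≫ homPost (T.j.obj x) (T.η.app₀ x) = T.η.app₀ x := by
      rw [← Category.assoc, T.j.map_id, eId_homPost]
    exact h
  map_comp x y z := by
    have h : eComp V x y z ≫ T.j.map x z ≫ homPost (T.j.obj x) (T.η.app₀ z) =
        ((T.j.map x y ≫ homPost (T.j.obj x) (T.η.app₀ y)) ⊗ₘ
          (T.j.map y z ≫ homPost (T.j.obj y) (T.η.app₀ z))) ≫
            (T.j.obj x ⟶[V] T.t.obj y) ◁ T.ext.app₁ y z ≫
              eComp V (T.j.obj x) (T.t.obj y) (T.t.obj z) := by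
      rw [T.j.map_comp_assoc, ← tensorHom_comp_tensorHom_assoc]
      congr 1
      rw [eComp_homPost, MonoidalCategory.tensorHom_def', Category.assoc, ← whisker_exchange_assoc,
        homPost_comp, ← MonoidalCategory.whiskerLeft_comp_assoc,
        ← MonoidalCategory.whiskerLeft_comp_assoc, Category.assoc, T.ext_unit, Category.comp_id]
    exact h

end RelativeMonad

end VCat

end

noncomputable section

namespace VCat

variable {V : Type v} [Category.{w} V] [MonoidalCategory V]

/-! Everything rests on `Kl(T)` having the objects of `A` and the domain of an opextension operator
as its homs. An operator `⋉ : E(j, t) ⇒ B(a, a)` is then the hom-action of a functor `Kl(T) → B`: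
the unit law is preservation of identities and the extension law is preservation of composition.
That this functor restricts along `k_T` to `a` is `kleisliInclusion_map_opext`, which uses
naturality of `η`, right naturality of `⋉` and the unit law. Conversely, the operator of `k_T` is
the identity, so the operator of `k_T ; F` is `F` on homs, and `F` is recovered from it.

For forms, `B(1, F)` and `B(1, k_T ; F)` have the same objects and the same left action; only the
right actions differ, by `Kl(T)` and by `A`. So `β` and `α` are the same family of morphisms, and
the right naturality required of `β` is exactly the condition that `α` be graded. -/

theorem enrichedFunctor_ext_map {C D : VCategory.{w, v, u} V} {F G : EnrichedFunctor V C D}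
    (hobj : F.obj = G.obj) (hmap : ∀ x y, HEq (F.map x y) (G.map x y)) : F = G := by
  obtain ⟨obj, map, _, _⟩ := F
  obtain ⟨obj', map', _, _⟩ := G
  obtain rfl : obj = obj' := hobj
  obtain rfl : map = map' := by
    funext x y
    exact eq_of_heq (hmap x y)
  rfl

open Chain

/-! ### Extensionality and construction of unary forms. -/

namespace Form

@[ext]
theorem ext_app {C D : VCategory.{w, v, u} V} {c : Chain C D} {q : Distributor C D}
    {φ ψ : Form c q} (h : ∀ {x : C} {z : D} (s : Points x c z), φ.app s = ψ.app s) : φ = ψ := by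
  obtain ⟨f, _⟩ := φ
  obtain ⟨g, _⟩ := ψ
  obtain rfl : @f = @g := by
    funext x z s
    exact h s
  rfl

theorem ext_app₁ {C D : VCategory.{w, v, u} V} {p q : Distributor C D}
    {φ ψ : Form (Chain.single p) q} (h : ∀ x y, φ.app₁ x y = ψ.app₁ x y) : φ = ψ := by
  ext x z s
  cases s with
  | snoc s z =>
    cases s with
    | nil => exact (cancel_epi _).1 (h x z)

/-- The unary `V`-form with given components. -/
def mk₁ {C D : VCategory.{w, v, u} V} {p q : Distributor C D}
    (θ : ∀ x y, p.obj x y ⟶ q.obj x y)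
    (hl : ∀ x' x z, p.lact x' x z ≫ θ x' z = (x' ⟶[V] x) ◁ θ x z ≫ q.lact x' x z)
    (hr : ∀ x z z', p.ract x z z' ≫ θ x z' = θ x z ▷ (z ⟶[V] z') ≫ q.ract x z z') :
    Form (Chain.single p) q where
  app {x z} s := match s with
    | .snoc .nil z => (λ_ (p.obj x z)).hom ≫ θ x z
  natural := by
    refine ⟨fun {x x' z s s' l} hs => ?_, fun {x y} s z z' => ?_, fun {x z s s' X r l} hs => ?_⟩
    · cases hs with
      | single => simp [hl]
      | snoc h => cases h
    · cases s
      simp [hr]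
    -- A chain with one member has no inner place.
    · cases hs with
      | snoc h => cases h

@[simp]
theorem mk₁_app₁ {C D : VCategory.{w, v, u} V} {p q : Distributor C D}
    (θ : ∀ x y, p.obj x y ⟶ q.obj x y) (hl hr) (x : C) (y : D) :
    (mk₁ θ hl hr).app₁ x y = θ x y := by
  simp [mk₁, app₁]

/-- Right naturality of a unary form, freed of the unit object with which the tensor of a chain
begins. -/
theorem app₁_ract {C D : VCategory.{w, v, u} V} {p q : Distributor C D}
    (φ : Form (Chain.single p) q) (x : C) (z z' : D) :
    p.ract x z z' ≫ φ.app₁ x z' = φ.app₁ x z ▷ (z ⟶[V] z') ≫ q.ract x z z' := by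
  have h := φ.natural.2.1 (.nil (x₀ := x)) z z'
  rw [app₁, app₁, comp_whiskerRight, Category.assoc, ← h]
  simp

end Form

/-! ### The Kleisli opalgebra. -/

namespace RelativeMonad

variable {A E : VCategory.{w, v, u} V} (T : RelativeMonad A E)

/-- Naturality of `η` rewrites `k_T` on homs, given as `j` followed by `η_y`, as `η_x` acted on by
`t`. Right naturality of `⋉` turns this into `⋉(η_x)` acted on by `a`, and `⋉(η_x)` is an identity.
-/
theorem kleisliInclusion_map_opext {B : VCategory.{w, v, u} V} {a : EnrichedFunctor V A B}
    (s : T.OpalgebraStructure a) (x y : A) :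
    (T.j.map x y ≫ homPost (T.j.obj x) (T.η.app₀ y)) ≫ s.opext.app₁ x y = a.map x y := by
  have hη : (λ_ (x ⟶[V] y)).inv ≫ T.η.app₀ x ▷ (x ⟶[V] y) ≫ (homOf T.j T.t).ract x x y =
      (ρ_ (x ⟶[V] y)).inv ≫ (x ⟶[V] y) ◁ T.η.app₀ y ≫ (homOf T.j T.t).lact x y y :=
    T.η.natural x y
  have hk : T.j.map x y ≫ homPost (T.j.obj x) (T.η.app₀ y) =
      (ρ_ (x ⟶[V] y)).inv ≫ (x ⟶[V] y) ◁ T.η.app₀ y ≫ (homOf T.j T.t).lact x y y := by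
    rw [homPost, rightUnitor_inv_naturality_assoc, whisker_exchange_assoc]
  rw [hk, ← hη, Category.assoc, Category.assoc, s.opext.app₁_ract, ← comp_whiskerRight_assoc,
    s.unit_opext]
  change _ ≫ _ ▷ _ ≫ _ ◁ a.map x y ≫ eComp V _ _ _ = _
  rw [← whisker_exchange_assoc, ← leftUnitor_inv_naturality_assoc, e_id_comp, Category.comp_id]

/-- The extension operator, as an opalgebra structure on `t`. -/
def extStructure : T.OpalgebraStructure T.t where
  opext := T.ext
  unit_opext := T.unit_ext
  opext_opext := T.ext_assoc

/-- The case of `t` as an opalgebra under `†`; it makes the identity operator of `k_T` compatible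
with the right action of `A`. -/
theorem kleisliInclusion_map_ext (x y : A) :
    (T.j.map x y ≫ homPost (T.j.obj x) (T.η.app₀ y)) ≫ T.ext.app₁ x y = T.t.map x y :=
  T.kleisliInclusion_map_opext T.extStructure x y

/-- The opextension operator of `k_T`, given by the identity `E(j, t) = Kl(T)(k_T, k_T)`. -/
def kleisliOpext :
    Form (Chain.single (homOf T.j T.t)) (homOf T.kleisliInclusion T.kleisliInclusion) :=
  Form.mk₁ (q := homOf T.kleisliInclusion T.kleisliInclusion)
    (fun x y => 𝟙 (T.j.obj x ⟶[V] T.t.obj y))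
    (fun x' x z => by
      change (T.j.map x' x ▷ (T.j.obj x ⟶[V] T.t.obj z) ≫ eComp V _ _ _) ≫ 𝟙 _ =
        _ ◁ 𝟙 _ ≫ (T.j.map x' x ≫ homPost _ (T.η.app₀ x)) ▷ (T.j.obj x ⟶[V] T.t.obj z) ≫
          (_ ◁ T.ext.app₁ x z) ≫ eComp V _ _ _
      -- `homPost_comp` moves `η_x` from the first factor to the second, where it meets `†` and
      -- cancels by `ext_unit`.
      rw [MonoidalCategory.whiskerLeft_id, Category.id_comp, Category.comp_id,
        ← whisker_exchange_assoc, comp_whiskerRight_assoc, homPost_comp,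
        ← whisker_exchange_assoc, ← MonoidalCategory.whiskerLeft_comp_assoc, T.ext_unit,
        MonoidalCategory.whiskerLeft_id, Category.id_comp])
    (fun x z z' => by
      change ((T.j.obj x ⟶[V] T.t.obj z) ◁ T.t.map z z' ≫ eComp V _ _ _) ≫ 𝟙 _ =
        𝟙 _ ▷ _ ≫ (T.j.obj x ⟶[V] T.t.obj z) ◁ (T.j.map z z' ≫ homPost _ (T.η.app₀ z')) ≫
          (_ ◁ T.ext.app₁ z z') ≫ eComp V _ _ _
      rw [id_whiskerRight, Category.id_comp, Category.comp_id,
        ← MonoidalCategory.whiskerLeft_comp_assoc, T.kleisliInclusion_map_ext])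

theorem kleisliOpext_app₁ (x y : A) :
    T.kleisliOpext.app₁ x y = 𝟙 (T.j.obj x ⟶[V] T.t.obj y) :=
  Form.mk₁_app₁ _ _ _ x y

/-- The opalgebra structure on `k_T`. -/
def kleisliStructure : T.OpalgebraStructure T.kleisliInclusion where
  opext := T.kleisliOpext
  unit_opext x := by
    rw [kleisliOpext_app₁]
    exact Category.comp_id (T.η.app₀ x)
  opext_opext x y z := by
    rw [kleisliOpext_app₁, kleisliOpext_app₁, kleisliOpext_app₁]
    change (𝟙 (T.j.obj x ⟶[V] T.t.obj y) ⊗ₘ 𝟙 (T.j.obj y ⟶[V] T.t.obj z)) ≫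
        (T.j.obj x ⟶[V] T.t.obj y) ◁ T.ext.app₁ y z ≫ eComp V _ _ _ =
      (T.j.obj x ⟶[V] T.t.obj y) ◁ T.ext.app₁ y z ≫ eComp V _ _ _ ≫ 𝟙 _
    rw [id_tensorHom_id, Category.id_comp, Category.comp_id]

/-- The Kleisli opalgebra `(k_T, 1)`. -/
def kleisliOpalgebra : T.Opalgebra T.kleisli where
  functor := T.kleisliInclusion
  str := T.kleisliStructure

theorem kleisliOpalgebra_postcomp_app₁ {B : VCategory.{w, v, u} V}
    (F : EnrichedFunctor V T.kleisli B) (x y : A) :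
    (T.kleisliOpalgebra.postcomp F).str.opext.app₁ x y =
      F.map (T.kleisliInclusion.obj x) (T.kleisliInclusion.obj y) := by
  refine (Form.app₁_postcomp T.kleisliOpext F x y).trans ?_
  rw [kleisliOpext_app₁]
  exact Category.id_comp (F.map (T.kleisliInclusion.obj x) (T.kleisliInclusion.obj y))

/-! ### The universal property. -/

namespace Opalgebra

variable {T}

/-- The type of the operator depends on the underlying functor, hence `HEq`. In the application the
functors agree definitionally on objects, so plain equalities of components suffice. -/
theorem ext_opext {B : VCategory.{w, v, u} V} {o o' : T.Opalgebra B}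
    (h : o.functor = o'.functor)
    (h' : ∀ x y, HEq (o.str.opext.app₁ x y) (o'.str.opext.app₁ x y)) : o = o' := by
  obtain ⟨a, s, _, _⟩ := o
  obtain ⟨a', s', _, _⟩ := o'
  obtain rfl : a = a' := h
  obtain rfl : s = s' := Form.ext_app₁ fun x y => eq_of_heq (h' x y)
  rfl

/-- The `V`-functor out of the Kleisli `V`-category induced by an opalgebra. -/
def kleisliDesc {B : VCategory.{w, v, u} V} (o : T.Opalgebra B) :
    EnrichedFunctor V T.kleisli B where
  obj x := o.functor.obj x
  map x y := o.str.opext.app₁ x y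
  map_id x := o.str.unit_opext x
  map_comp x y z :=
    (Category.assoc _ _ _).trans (o.str.opext_opext x y z).symm

theorem kleisliOpalgebra_postcomp_kleisliDesc {B : VCategory.{w, v, u} V} (o : T.Opalgebra B) :
    T.kleisliOpalgebra.postcomp o.kleisliDesc = o :=
  ext_opext
    (enrichedFunctor_ext_map rfl fun x y =>
      heq_of_eq (T.kleisliInclusion_map_opext o.str x y))
    fun x y => heq_of_eq (T.kleisliOpalgebra_postcomp_app₁ o.kleisliDesc x y)

/-- This gives uniqueness of the induced functor: the operator of `k_T ; F` already contains the
whole action of `F` on homs. -/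
theorem kleisliDesc_postcomp {B : VCategory.{w, v, u} V} (F : EnrichedFunctor V T.kleisli B) :
    (T.kleisliOpalgebra.postcomp F).kleisliDesc = F :=
  enrichedFunctor_ext_map rfl fun x y => heq_of_eq (T.kleisliOpalgebra_postcomp_app₁ F x y)

/-- The `V`-form induced by a graded morphism between opalgebras that factor through `k_T`. -/
def kleisliDescForm {B B' : VCategory.{w, v, u} V} (F : EnrichedFunctor V T.kleisli B)
    (F' : EnrichedFunctor V T.kleisli B') (c : Chain B' B)
    (α : Form (c.snoc (homFrom (T.kleisliOpalgebra.postcomp F).functor))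
      (homFrom (T.kleisliOpalgebra.postcomp F').functor))
    (hα : (T.kleisliOpalgebra.postcomp F).IsGradedMorphism (T.kleisliOpalgebra.postcomp F') α) :
    Form (c.snoc (homFrom F)) (homFrom F') where
  app {x z} s := match s with
    -- The point is rebuilt because the two chains end in different distributors; the tensors agree
    -- definitionally.
    | .snoc s y => α.app (.snoc (p := homFrom (T.kleisliOpalgebra.postcomp F).functor) s y)
  natural := by
    refine ⟨fun {x x' z s s' l} hs => ?_, fun {x y} s z z' => ?_, fun {x z s s' X r l} hs => ?_⟩
    · cases hs with
      | single z =>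
        exact α.natural.1
          (Points.LeftStep.single (p := homFrom (T.kleisliOpalgebra.postcomp F).functor) z)
      | snoc h z =>
        exact α.natural.1
          (Points.LeftStep.snoc (p := homFrom (T.kleisliOpalgebra.postcomp F).functor) h z)
    -- Once the operators of `k_T ; F` and `k_T ; F'` are replaced by the hom-actions of `F` and
    -- `F'`, the graded condition is right naturality over `Kl(T)`.
    · have h : ∀ z z' : A, _ := hα s
      simp only [action, kleisliOpalgebra_postcomp_app₁] at h
      exact h z z'
    · cases hs with
      | last s x x' z =>
        exact α.natural.2.2
          (Points.InnerStep.last (q := homFrom (T.kleisliOpalgebra.postcomp F).functor) s x x' z)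
      | snoc h z =>
        exact α.natural.2.2
          (Points.InnerStep.snoc (p := homFrom (T.kleisliOpalgebra.postcomp F).functor) h z)

theorem isOpalgebraObject_kleisliOpalgebra : T.kleisliOpalgebra.IsOpalgebraObject where
  existsUnique_functor o' :=
    ⟨o'.kleisliDesc, kleisliOpalgebra_postcomp_kleisliDesc o', fun F hF => by
      subst hF
      exact (kleisliDesc_postcomp F).symm⟩
  existsUnique_form F F' c α hα :=
    ⟨kleisliDescForm F F' c α hα, fun s y => rfl, fun β hβ => by
      ext x z s
      cases s with
      -- The last object lies in `Kl(T)`, hence is an object of `A`, so restriction along `k_T`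
      -- determines every component.
      | snoc s z => exact hβ s z⟩

end Opalgebra

end RelativeMonad

end VCat

end

theorem mainTheorem12 {V : Type v} [Category.{w} V] [MonoidalCategory V]
    {A E : VCat.VCategory.{w, v, u} V} (T : VCat.RelativeMonad A E) :
    T.AdmitsOpalgebraObject ∧
      ∃ s : T.OpalgebraStructure T.kleisliInclusion,
        (∀ x y : A, s.opext.app₁ x y = 𝟙 (T.j.obj x ⟶[V] T.t.obj y)) ∧
        VCat.RelativeMonad.Opalgebra.IsOpalgebraObject
          { functor := T.kleisliInclusion, str := s } :=
  ⟨⟨T.kleisli, T.kleisliOpalgebra,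
      VCat.RelativeMonad.Opalgebra.isOpalgebraObject_kleisliOpalgebra⟩,
    T.kleisliStructure, T.kleisliOpext_app₁,
    VCat.RelativeMonad.Opalgebra.isOpalgebraObject_kleisliOpalgebra⟩
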